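/- Let $\sigma$ be a relational signature with only finitely many relation symbols of arity at least $2$ (the number of unary symbols is not restricted). Let $(\mathbf A_n)_{n\in\mathbb N}$ be a sequence of finite $\sigma$-structures, the domain $A_n$ of $\mathbf A_n$ being endowed with a probability measure $\nu_n$ defined on all subsets of $A_n$. Distances in a structure are distances in its Gaifman graph, in which two distinct elements are adjacent if they occur together in a tuple of some relation; elements of distinct components are at distance $\infty$. A first-order formula $\phi(x_1,\dots,x_p)$ is called local if there is $r\in\mathbb N$ such that for every $\sigma$-structure $\mathbf A$ (finite or infinite) and all $v_1,\dots,v_p\in A$, $\mathbf A\models\phi(v_1,\dots,v_p)$ if and only if $\phi(v_1,\dots,v_p)$ holds in the substructure of $\mathbf A$ induced by the set of elements at distance at most $r$ from $\{v_1,\dots,v_p\}$. Assume that $(\mathbf A_n)$ is local-convergent, that is, for every $p$ and every local formula $\phi$ with free variables $x_1,\dots,x_p$ the sequence of probabilities $\langle\phi,\mathbf A_n\rangle=\nu_n^{\otimes p}\bigl(\{(v_1,\dots,v_p)\in A_n^p:\mathbf A_n\models\phi(v_1,\dots,v_p)\}\bigr)$ converges as $n\to\infty$. For $d\in\mathbb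 N$ let $D_{d,n}(v)=\nu_n(\{y\in A_n:\mathrm{dist}(v,y)\le d\})$, regarded as a random variable on the probability space $(A_n,\nu_n)$. Then the following hold. 1. For every $d$ the distributions of $D_{d,n}$ converge weakly as $n\to\infty$ to a probability distribution $D_d$ on $\mathbb R$, and the distributions $D_d$ converge weakly as $d\to\infty$ to a (necessarily unique) probability distribution $D$, the spectrum distribution of the sequence; $D$ is carried by $[0,1]$. 2. $D$ is purely discrete: there is a countable set $S\subset\mathbb R$ with $D(\mathbb R\setminus S)=0$. 3. Let $F$ be the cumulative distribution function of $D$ and let $p(x)=F(x)-\lim_{\epsilon\to0^+}F(x-\epsilon)$ be its mass function. Then for every $x\in[0,1]$, either $p(x)=0$ or $p(x)\ge x$. -/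

import Mathlib

open Filter Topology MeasureTheory ProbabilityTheory

universe u v w

noncomputable section

namespace SpectrumClustering

open FirstOrder.Language

/-- The Gaifman graph of an `L`-structure on `M`: two distinct elements are adjacent when they occur
together in some tuple that belongs to some relation of the structure. -/
def gaifman (L : FirstOrder.Language.{u, v}) (M : Type w) [L.Structure M] : SimpleGraph M where
  Adj x y := x ≠ y ∧ ∃ (k : ℕ) (R : L.Relations k) (t : Fin k → M),
    Structure.RelMap R t ∧ x ∈ Set.range t ∧ y ∈ Set.range t
  symm := ⟨fun _ _ ⟨hne, k, R, t, ht, hx, hy⟩ => ⟨hne.symm, k, R, t, ht, hy, hx⟩⟩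
  loopless := ⟨fun _ h => h.1 rfl⟩

/-- The set of all elements at distance at most `d` (in the Gaifman graph) from some element
of `X`. Elements of different connected components are at distance `⊤`. -/
def closedNbhd (L : FirstOrder.Language.{u, v}) {M : Type w} [L.Structure M] (d : ℕ) (X : Set M) : Set M :=
  {y | ∃ x ∈ X, (gaifman L M).edist x y ≤ d}

/-- The substructure induced by a set of elements; the signature is relational, so that every set
of elements is the domain of a substructure. -/
def inducedSub (L : FirstOrder.Language.{u, v}) [L.IsRelational] {M : Type w} [L.Structure M] (X : Set M) :
    L.Substructure M where
  carrier := X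
  fun_mem f := isEmptyElim f

theorem mem_closedNbhd_self (L : FirstOrder.Language.{u, v}) {M : Type w} [L.Structure M] (d : ℕ)
    {X : Set M} {x : M} (hx : x ∈ X) : x ∈ closedNbhd L d X :=
  ⟨x, hx, by simp⟩

/-- A first-order formula `φ` with free variables `x_1, …, x_p` is `r`-local if, for every structure
(finite or not) and all elements `a_1, …, a_p`, it holds at `a_1, …, a_p` in the structure if and
only if it holds at `a_1, …, a_p` in the substructure induced by the
`r`-neighbourhood of `{a_1, …, a_p}`. -/
def IsRLocal (L : FirstOrder.Language.{u, v}) [L.IsRelational] {p : ℕ} (r : ℕ) (φ : L.Formula (Fin p)) :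
    Prop :=
  ∀ (M : Type w) [L.Structure M] (a : Fin p → M),
    φ.Realize a ↔
      φ.Realize (M := inducedSub L (closedNbhd L r (Set.range a)))
        (fun i => ⟨a i, mem_closedNbhd_self L r (Set.mem_range_self i)⟩)

/-- A formula is local if it is `r`-local for some `r`. -/
def IsLocal (L : FirstOrder.Language.{u, v}) [L.IsRelational] {p : ℕ} (φ : L.Formula (Fin p)) : Prop :=
  ∃ r : ℕ, IsRLocal.{u, v, w} L r φ

/-- The Stone pairing `⟨φ, A⟩` of a formula with `p` free variables and a structure whose domain
carries a probability measure `ν`: the probability that `φ` is satisfied by `p` independent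
`ν`-random elements. -/
def stonePairing {L : FirstOrder.Language.{u, v}} {p : ℕ} (φ : L.Formula (Fin p)) {M : Type w} [L.Structure M]
    [MeasurableSpace M] (ν : ProbabilityMeasure M) : ℝ :=
  (Measure.pi fun _ : Fin p => (ν : Measure M)).real {a | φ.Realize a}

/-- A sequence of structures with probability measures on their domains is local-convergent if
the Stone pairing with every local formula converges. -/
def LocalConvergent (L : FirstOrder.Language.{u, v}) [L.IsRelational] (A : ℕ → Type w)
    [∀ n, L.Structure (A n)] [∀ n, MeasurableSpace (A n)] (ν : ∀ n, ProbabilityMeasure (A n)) :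
    Prop :=
  ∀ (p : ℕ) (φ : L.Formula (Fin p)), IsLocal.{u, v, w} L φ →
    ∃ l : ℝ, Tendsto (fun n => stonePairing φ (ν n)) atTop (𝓝 l)

/-- The measure of the ball of radius `d` centred at `a`. -/
def ballMass (L : FirstOrder.Language.{u, v}) {M : Type w} [L.Structure M] [MeasurableSpace M]
    (ν : ProbabilityMeasure M) (d : ℕ) (a : M) : ℝ :=
  (ν : Measure M).real (closedNbhd L d {a})

/-- The distribution (on the real line) of the measure of the ball of radius `d` centred at a
`ν`-random element of a finite structure. -/
def ballLaw (L : FirstOrder.Language.{u, v}) {M : Type w} [L.Structure M] [MeasurableSpace M]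
    [DiscreteMeasurableSpace M] (ν : ProbabilityMeasure M) (d : ℕ) : ProbabilityMeasure ℝ :=
  ν.map (f := ballMass L ν d) (Measurable.of_discrete).aemeasurable

/-- `D` is a spectrum distribution of the sequence: for each `d` the distributions of the measure
of a random ball of radius `d` converge weakly as `n → ∞`, and these limits converge weakly to `D`
as `d → ∞`. -/
def IsSpectrumDistribution (L : FirstOrder.Language.{u, v}) (A : ℕ → Type w) [∀ n, L.Structure (A n)]
    [∀ n, MeasurableSpace (A n)] [∀ n, DiscreteMeasurableSpace (A n)]
    (ν : ∀ n, ProbabilityMeasure (A n)) (D : ProbabilityMeasure ℝ) : Prop :=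
  ∃ E : ℕ → ProbabilityMeasure ℝ,
    (∀ d, Tendsto (fun n => ballLaw L (ν n) d) atTop (𝓝 (E d))) ∧ Tendsto E atTop (𝓝 D)

/-- A probability distribution on the line is (purely) discrete if it is carried by a
countable set. -/
def IsPurelyDiscrete (D : ProbabilityMeasure ℝ) : Prop :=
  ∃ S : Set ℝ, S.Countable ∧ (D : Measure ℝ) Sᶜ = 0

/-- The mass function `p(x) = F(x) - lim_{ε → 0+} F(x - ε)` of a distribution with cumulative
distribution function `F`. -/
def massFunction (D : ProbabilityMeasure ℝ) (x : ℝ) : ℝ :=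
  cdf (D : Measure ℝ) x - Function.leftLim (cdf (D : Measure ℝ)) x

end SpectrumClustering

end

open SpectrumClustering

/-! The `k`-th moment of the mass of a random `d`-ball is the probability that `k` further
independent elements fall into that ball (`integral_pow_ballLaw`), the Stone pairing of a local
formula. So all moments converge as `n → ∞`; they increase with `d` and are at most 1, so their
limits converge as `d → ∞`. On `[0, 1]` convergent moments give weak convergence
(`exists_tendsto_of_moments`).

For the atoms, let `x` lie in the support of `D`. Since the first moments converge in `d`, typical
balls hardly grow from radius `d` to `3 * d`, so some `d`-ball of mass near `x` has a `3 * d`-ball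
of mass near `x`. Every element of this `d`-ball then has a `2 * d`-ball of mass near `x`, and these
elements alone have measure about `x`. In the limit `D {x} ≥ x`. Thus each point of the support is 0
or an atom, and there are only countably many atoms. -/

namespace SpectrumClustering

open FirstOrder FirstOrder.Language

/-! ### First-order definability and locality of balls. -/

section Logic

variable (L : FirstOrder.Language.{u, v})

/-- Two elements are close if they are equal or occur together in a tuple of a relation of arity
at least two. -/
def Close {M : Type w} [L.Structure M] (x y : M) : Prop :=
  x = y ∨ ∃ R : {R : Σ k, L.Relations k | 2 ≤ R.1}, ∃ t : Fin R.1.1 → M,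
    Structure.RelMap R.1.2 t ∧ (∃ i, t i = x) ∧ ∃ j, t j = y

/-- A tuple with two distinct entries has arity at least two, so unary relations create no edges.
Hence a finite disjunction defines adjacency, however many unary symbols there are. -/
theorem close_iff {M : Type w} [L.Structure M] (x y : M) :
    Close L x y ↔ x = y ∨ (gaifman L M).Adj x y := by
  constructor
  · rintro (h | ⟨R, t, ht, hx, hy⟩)
    · exact Or.inl h
    · by_cases hxy : x = y
      · exact Or.inl hxy
      · exact Or.inr ⟨hxy, R.1.1, R.1.2, t, ht, hx, hy⟩
  · rintro (h | ⟨hne, k, R, t, ht, ⟨i, hi⟩, ⟨j, hj⟩⟩)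
    · exact Or.inl h
    · have hij : i ≠ j := fun h => hne (by rw [← hi, ← hj, h])
      have hk : 2 ≤ k := by
        by_contra hk
        exact hij (Fin.ext (by omega))
      exact Or.inr ⟨⟨⟨k, R⟩, hk⟩, t, ht, ⟨i, hi⟩, ⟨j, hj⟩⟩

/-- The formula defining closeness. -/
noncomputable def closeFormula [Finite {R : Σ k, L.Relations k | 2 ≤ R.1}] :
    L.Formula (Fin 2) :=
  (Term.equal (Term.var 0) (Term.var 1)) ⊔
    Formula.iSup fun R : {R : Σ k, L.Relations k | 2 ≤ R.1} =>
      Formula.iExs (Fin R.1.1)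
        (R.1.2.formula (fun i => Term.var (Sum.inr i)) ⊓
          (Formula.iSup (fun i : Fin R.1.1 =>
            Term.equal (Term.var (Sum.inr i)) (Term.var (Sum.inl 0)))) ⊓
          (Formula.iSup (fun i : Fin R.1.1 =>
            Term.equal (Term.var (Sum.inr i)) (Term.var (Sum.inl 1)))))

theorem realize_closeFormula [Finite {R : Σ k, L.Relations k | 2 ≤ R.1}]
    {M : Type w} [L.Structure M] (a : Fin 2 → M) :
    (closeFormula L).Realize a ↔ Close L (a 0) (a 1) := by
  simp only [closeFormula, Close, Formula.realize_sup, Formula.realize_inf, Formula.realize_equal,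
    Term.realize_var, Formula.realize_iSup, Formula.realize_iExs, Formula.realize_rel,
    Sum.elim_inl, Sum.elim_inr, and_assoc]

theorem edist_le_succ_iff {M : Type w} [L.Structure M] (d : ℕ) (x y : M) :
    (gaifman L M).edist x y ≤ (d + 1 : ℕ) ↔
      ∃ z, (gaifman L M).edist x z ≤ d ∧ Close L z y := by
  simp only [close_iff]
  constructor
  · intro h
    have hne : (gaifman L M).edist y x ≠ ⊤ := by
      rw [SimpleGraph.edist_comm]
      exact ne_top_of_le_ne_top (ENat.natCast_ne_top _) h
    obtain ⟨p, hp⟩ := SimpleGraph.exists_walk_of_edist_ne_top hne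
    rw [SimpleGraph.edist_comm, ← hp] at h
    cases p with
    | nil => exact ⟨x, by simp, Or.inl rfl⟩
    | @cons _ z _ hadj q =>
      refine ⟨z, ?_, Or.inr hadj.symm⟩
      rw [SimpleGraph.edist_comm]
      refine (SimpleGraph.edist_le q).trans ?_
      simp only [SimpleGraph.Walk.length_cons, Nat.cast_le] at h ⊢
      omega
  · rintro ⟨z, hz, h⟩
    have h1 : (gaifman L M).edist z y ≤ 1 := by
      rw [SimpleGraph.edist_le_one_iff_adj_or_eq]
      exact h.symm
    push_cast
    exact SimpleGraph.edist_triangle.trans (add_le_add hz h1)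

/-- The formula expressing that two elements are at distance at most `d`. -/
noncomputable def distFormula [Finite {R : Σ k, L.Relations k | 2 ≤ R.1}] :
    ℕ → L.Formula (Fin 2)
  | 0 => Term.equal (Term.var 0) (Term.var 1)
  | d + 1 => Formula.iExs Unit
      (((distFormula d).relabel ![Sum.inl 0, Sum.inr ()] : L.Formula (Fin 2 ⊕ Unit)) ⊓
        (closeFormula L).relabel ![Sum.inr (), Sum.inl 1])

theorem realize_distFormula [Finite {R : Σ k, L.Relations k | 2 ≤ R.1}]
    {M : Type w} [L.Structure M] (d : ℕ) (a : Fin 2 → M) :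
    (distFormula L d).Realize a ↔ (gaifman L M).edist (a 0) (a 1) ≤ d := by
  induction d generalizing a with
  | zero => simp [distFormula, Formula.realize_equal]
  | succ d ih =>
    rw [edist_le_succ_iff]
    simp only [distFormula, Formula.realize_iExs, Formula.realize_inf, Formula.realize_relabel, ih,
      realize_closeFormula, Function.comp_apply, Matrix.cons_val_zero, Matrix.cons_val_one,
      Sum.elim_inl, Sum.elim_inr]
    exact ⟨fun ⟨i, h⟩ => ⟨i (), h⟩, fun ⟨z, h⟩ => ⟨fun _ => z, h⟩⟩

/-- The formula expressing that `x_1, …, x_k` lie in the ball of radius `d` around `x_0`. -/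
noncomputable def ballFormula [Finite {R : Σ k, L.Relations k | 2 ≤ R.1}] (d k : ℕ) :
    L.Formula (Fin (k + 1)) :=
  Formula.iInf fun i : Fin k => (distFormula L d).relabel ![0, i.succ]

theorem realize_ballFormula [Finite {R : Σ k, L.Relations k | 2 ≤ R.1}]
    {M : Type w} [L.Structure M] (d k : ℕ) (a : Fin (k + 1) → M) :
    (ballFormula L d k).Realize a ↔ ∀ i : Fin k, (gaifman L M).edist (a 0) (a i.succ) ≤ d := by
  simp [ballFormula, Formula.realize_iInf, Formula.realize_relabel, realize_distFormula]

variable [L.IsRelational]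

theorem Close.of_inducedSub {M : Type w} [L.Structure M] {X : Set M} {x y : inducedSub L X}
    (h : Close L x y) : Close L (x : M) (y : M) := by
  obtain h | ⟨R, t, ht, ⟨i, hi⟩, ⟨j, hj⟩⟩ := h
  · exact Or.inl (congrArg _ h)
  · exact Or.inr ⟨R, fun i => (t i : M), ht, ⟨i, congrArg _ hi⟩, ⟨j, congrArg _ hj⟩⟩

theorem edist_le_of_inducedSub {M : Type w} [L.Structure M] {X : Set M} (d : ℕ)
    (x y : inducedSub L X) (h : (gaifman L (inducedSub L X)).edist x y ≤ d) :
    (gaifman L M).edist (x : M) (y : M) ≤ d := by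
  induction d generalizing y with
  | zero =>
    obtain rfl : x = y := by simpa using h
    simp
  | succ d ih =>
    rw [edist_le_succ_iff] at h ⊢
    obtain ⟨z, hz, hzy⟩ := h
    exact ⟨z, ih z hz, hzy.of_inducedSub⟩

theorem edist_inducedSub_le {M : Type w} [L.Structure M] {X : Set M} {r : ℕ} (d : ℕ) (hd : d ≤ r)
    {x : M} (hx : x ∈ X) (y : M) (h : (gaifman L M).edist x y ≤ d) (hx' : x ∈ closedNbhd L r X)
    (hy' : y ∈ closedNbhd L r X) :
    (gaifman L (inducedSub L (closedNbhd L r X))).edist ⟨x, hx'⟩ ⟨y, hy'⟩ ≤ d := by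
  induction d generalizing y with
  | zero =>
    obtain rfl : x = y := by simpa using h
    simp
  | succ d ih =>
    rw [edist_le_succ_iff] at h ⊢
    obtain ⟨z, hz, hzy⟩ := h
    have hmem : ∀ z', Close L z z' → z' ∈ closedNbhd L r X := fun z' hz' =>
      ⟨x, hx, ((edist_le_succ_iff L d x z').2 ⟨z, hz, hz'⟩).trans (by exact_mod_cast hd)⟩
    refine ⟨⟨z, hmem z (Or.inl rfl)⟩, ih (by omega) z hz _, ?_⟩
    obtain h | ⟨R, t, ht, ⟨i, hi⟩, ⟨j, hj⟩⟩ := hzy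
    · exact Or.inl (Subtype.ext h)
    -- The whole witnessing tuple must survive in the substructure: each of its entries is close to
    -- `z`, hence within `d + 1 ≤ r` of `x`.
    · refine Or.inr ⟨R, fun l => ⟨t l, hmem _ (Or.inr ⟨R, t, ht, ⟨i, hi⟩, ⟨l, rfl⟩⟩)⟩, ht,
        ⟨i, Subtype.ext hi⟩, ⟨j, Subtype.ext hj⟩⟩

theorem isLocal_ballFormula [Finite {R : Σ k, L.Relations k | 2 ≤ R.1}] (d k : ℕ) :
    IsLocal.{u, v, w} L (ballFormula L d k) := by
  refine ⟨d, fun M _ a => ?_⟩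
  rw [realize_ballFormula, realize_ballFormula]
  exact forall_congr' fun i =>
    ⟨fun h => edist_inducedSub_le L d le_rfl (Set.mem_range_self 0) _ h _ _,
      fun h => edist_le_of_inducedSub L d _ _ h⟩

end Logic

/-! ### The method of moments on the unit interval. -/

section WeakConvergence

theorem eventually_lt_measure_of_isOpen {ι : Type*} {l : Filter ι} {μ : ProbabilityMeasure ℝ}
    {μs : ι → ProbabilityMeasure ℝ} (h : Tendsto μs l (𝓝 μ)) {U : Set ℝ} (hU : IsOpen U)
    {c : ENNReal} (hc : c < (μ : Measure ℝ) U) : ∀ᶠ i in l, c < (μs i : Measure ℝ) U :=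
  eventually_lt_of_lt_liminf
    (hc.trans_le (ProbabilityMeasure.le_liminf_measure_open_of_tendsto h hU))

theorem le_measure_of_isClosed {ι : Type*} {l : Filter ι} [l.NeBot] {μ : ProbabilityMeasure ℝ}
    {μs : ι → ProbabilityMeasure ℝ} (h : Tendsto μs l (𝓝 μ)) {F : Set ℝ} (hF : IsClosed F)
    {c : ENNReal} (hc : ∀ᶠ i in l, c ≤ (μs i : Measure ℝ) F) : c ≤ (μ : Measure ℝ) F :=
  (le_limsup_of_frequently_le hc.frequently).trans
    (ProbabilityMeasure.limsup_measure_closed_le_of_tendsto h hF)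

/-- The measure is carried by the unit interval. -/
def OnUnitInterval (μ : ProbabilityMeasure ℝ) : Prop :=
  (μ : Measure ℝ) (Set.Icc 0 1) = 1

theorem OnUnitInterval.ae_mem {μ : ProbabilityMeasure ℝ} (h : OnUnitInterval μ) :
    ∀ᵐ x ∂(μ : Measure ℝ), x ∈ Set.Icc (0 : ℝ) 1 :=
  (prob_compl_eq_zero_iff measurableSet_Icc).2 h

theorem OnUnitInterval.of_tendsto {ι : Type*} {l : Filter ι} [l.NeBot] {μ : ProbabilityMeasure ℝ}
    {μs : ι → ProbabilityMeasure ℝ} (h : Tendsto μs l (𝓝 μ)) (hs : ∀ i, OnUnitInterval (μs i)) :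
    OnUnitInterval μ :=
  le_antisymm prob_le_one
    (le_measure_of_isClosed h isClosed_Icc (Eventually.of_forall fun i => (hs i).ge))

theorem OnUnitInterval.integrable {μ : ProbabilityMeasure ℝ} (h : OnUnitInterval μ) {f : ℝ → ℝ}
    (hf : Continuous f) : Integrable f (μ : Measure ℝ) := by
  have h1 : IntegrableOn f (Set.Icc 0 1) (μ : Measure ℝ) :=
    hf.continuousOn.integrableOn_compact isCompact_Icc
  rwa [IntegrableOn, Measure.restrict_eq_self_of_ae_mem h.ae_mem] at h1

theorem OnUnitInterval.integral_pow_mem_Icc {μ : ProbabilityMeasure ℝ} (h : OnUnitInterval μ)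
    (k : ℕ) : ∫ x, x ^ k ∂(μ : Measure ℝ) ∈ Set.Icc (0 : ℝ) 1 := by
  constructor
  · exact integral_nonneg_of_ae (h.ae_mem.mono fun x hx => pow_nonneg hx.1 k)
  · have := integral_mono_ae (h.integrable (continuous_pow k)) (integrable_const (1 : ℝ))
      (h.ae_mem.mono fun x hx => pow_le_one₀ hx.1 hx.2)
    simpa using this

theorem OnUnitInterval.tendsto_integral {ι : Type*} {l : Filter ι} [l.NeBot]
    {μ : ProbabilityMeasure ℝ}
    {μs : ι → ProbabilityMeasure ℝ} (h : Tendsto μs l (𝓝 μ)) (hs : ∀ i, OnUnitInterval (μs i))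
    {f : ℝ → ℝ} (hf : Continuous f) :
    Tendsto (fun i => ∫ x, f x ∂(μs i : Measure ℝ)) l (𝓝 (∫ x, f x ∂(μ : Measure ℝ))) := by
  -- `f` may be unbounded on the line; composing with the projection onto `[0, 1]` makes it bounded
  -- without changing the integrals.
  let g : BoundedContinuousFunction ℝ ℝ :=
    (BoundedContinuousFunction.mkOfCompact
      ⟨fun x : Set.Icc (0 : ℝ) 1 => f x, by fun_prop⟩).compContinuous
      ⟨Set.projIcc 0 1 zero_le_one, continuous_projIcc⟩
  have hg : ∀ ν : ProbabilityMeasure ℝ, OnUnitInterval ν →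
      ∫ x, g x ∂(ν : Measure ℝ) = ∫ x, f x ∂(ν : Measure ℝ) := fun ν hν => by
    refine integral_congr_ae ?_
    filter_upwards [hν.ae_mem] with x hx
    simp [g, Set.projIcc_of_mem zero_le_one hx]
  have := (ProbabilityMeasure.tendsto_iff_forall_integral_tendsto.1 h) g
  rw [hg μ (.of_tendsto h hs)] at this
  exact this.congr fun i => hg _ (hs i)

/-- Weierstrass approximation on `[0, 1]` reduces `f` to a polynomial, whose integrals are linear
combinations of moments. -/
theorem cauchySeq_integral_of_moments {μs : ℕ → ProbabilityMeasure ℝ}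
    (hs : ∀ n, OnUnitInterval (μs n))
    (hm : ∀ k : ℕ, ∃ m, Tendsto (fun n => ∫ x, x ^ k ∂(μs n : Measure ℝ)) atTop (𝓝 m))
    {f : ℝ → ℝ} (hf : Continuous f) : CauchySeq fun n => ∫ x, f x ∂(μs n : Measure ℝ) := by
  have hpoly : ∀ p : Polynomial ℝ,
      CauchySeq fun n => ∫ x, p.eval x ∂(μs n : Measure ℝ) := fun p => by
    choose m hm using hm
    have h1 : ∀ n, ∫ x, p.eval x ∂(μs n : Measure ℝ) =
        ∑ i ∈ Finset.range (p.natDegree + 1), p.coeff i * ∫ x, x ^ i ∂(μs n : Measure ℝ) := by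
      intro n
      simp_rw [Polynomial.eval_eq_sum_range, ← integral_const_mul]
      exact integral_finsetSum _ fun i _ => (hs n).integrable (by fun_prop)
    simp_rw [h1]
    exact (tendsto_finsetSum _ fun i _ => (hm i).const_mul (p.coeff i)).cauchySeq
  rw [Metric.cauchySeq_iff']
  intro ε hε
  obtain ⟨p, hp⟩ := exists_polynomial_near_of_continuousOn 0 1 f hf.continuousOn (ε / 3)
    (by positivity)
  have hclose : ∀ n, |∫ x, p.eval x ∂(μs n : Measure ℝ) - ∫ x, f x ∂(μs n : Measure ℝ)| ≤
      ε / 3 := fun n => by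
    rw [← integral_sub ((hs n).integrable p.continuous) ((hs n).integrable hf)]
    have := norm_integral_le_of_norm_le_const (μ := (μs n : Measure ℝ))
      (f := fun x => p.eval x - f x) (C := ε / 3)
      ((hs n).ae_mem.mono fun x hx => (hp x hx).le)
    simpa using this
  obtain ⟨N, hN⟩ := Metric.cauchySeq_iff'.1 (hpoly p) (ε / 3) (by positivity)
  refine ⟨N, fun n hn => ?_⟩
  have h1 := hN n hn
  have h2 := hclose n
  have h3 := hclose N
  rw [Real.dist_eq, abs_lt] at *
  rw [abs_le] at h2 h3
  constructor <;> linarith [h1.1, h1.2, h2.1, h2.2, h3.1, h3.2]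

/-- Probability measures on the unit interval whose moments converge are weakly convergent. -/
theorem exists_tendsto_of_moments {μs : ℕ → ProbabilityMeasure ℝ}
    (hs : ∀ n, OnUnitInterval (μs n))
    (hm : ∀ k : ℕ, ∃ m, Tendsto (fun n => ∫ x, x ^ k ∂(μs n : Measure ℝ)) atTop (𝓝 m)) :
    ∃ μ, Tendsto μs atTop (𝓝 μ) := by
  -- Tightness and Prokhorov's theorem give a cluster point; the integrals of bounded continuous
  -- functions, being convergent, must converge to their values there.
  have hcomp : IsCompact (closure {μ : ProbabilityMeasure ℝ | OnUnitInterval μ}) := by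
    refine isCompact_closure_of_isTightMeasureSet ?_
    rw [isTightMeasureSet_iff_exists_isCompact_measure_compl_le]
    rintro ε -
    refine ⟨Set.Icc 0 1, isCompact_Icc, ?_⟩
    rintro _ ⟨μ, hμ, rfl⟩
    rw [(prob_compl_eq_zero_iff measurableSet_Icc).2 hμ]
    exact zero_le
  obtain ⟨μ, -, hμ⟩ := hcomp.exists_mapClusterPt (f := atTop) (u := μs)
    (tendsto_principal.2 (Eventually.of_forall fun n => subset_closure (hs n)))
  refine ⟨μ, ProbabilityMeasure.tendsto_iff_forall_integral_tendsto.2 fun f => ?_⟩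
  obtain ⟨c, hc⟩ := cauchySeq_tendsto_of_complete
    (cauchySeq_integral_of_moments hs hm f.continuous)
  have hcl : MapClusterPt (∫ x, f x ∂(μ : Measure ℝ)) atTop
      (fun n => ∫ x, f x ∂(μs n : Measure ℝ)) :=
    hμ.continuousAt_comp
      (ProbabilityMeasure.continuous_integral_boundedContinuousFunction f).continuousAt
  rwa [eq_of_nhds_neBot (hcl.clusterPt.mono hc)]

end WeakConvergence

/-! ### Atoms, support and discreteness. -/

section Atoms

theorem le_measure_singleton_of_forall {D : ProbabilityMeasure ℝ} {x : ℝ}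
    (h : ∀ ε > 0, ENNReal.ofReal (x - ε) ≤
      (D : Measure ℝ) (Set.Icc (x - ε) (x + 2 * ε))) :
    ENNReal.ofReal x ≤ (D : Measure ℝ) {x} := by
  have h1 : Tendsto (fun r => (D : Measure ℝ) (Metric.cthickening r {x})) (𝓝[>] 0)
      (𝓝 ((D : Measure ℝ) {x})) :=
    (tendsto_measure_cthickening_of_isClosed ⟨1, one_pos, measure_ne_top _ _⟩
      isClosed_singleton).mono_left nhdsWithin_le_nhds
  have h2 : Tendsto (fun r : ℝ => ENNReal.ofReal (x - r / 2)) (𝓝[>] 0)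
      (𝓝 (ENNReal.ofReal x)) := by
    have : Tendsto (fun r : ℝ => ENNReal.ofReal (x - r / 2)) (𝓝 0)
      (𝓝 (ENNReal.ofReal (x - 0 / 2))) :=
      (ENNReal.continuous_ofReal.comp (by fun_prop : Continuous fun r : ℝ => x - r / 2)).tendsto 0
    simpa using this.mono_left nhdsWithin_le_nhds
  refine le_of_tendsto_of_tendsto h2 h1 ?_
  filter_upwards [self_mem_nhdsWithin] with r (hr : 0 < r)
  refine (h (r / 2) (by positivity)).trans (measure_mono ?_)
  rw [Metric.cthickening_singleton _ hr.le, Real.closedBall_eq_Icc]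
  exact Set.Icc_subset_Icc (by linarith) (by linarith)

theorem ofReal_massFunction (D : ProbabilityMeasure ℝ) (x : ℝ) :
    ENNReal.ofReal (massFunction D x) = (D : Measure ℝ) {x} := by
  rw [massFunction, ← StieltjesFunction.measure_singleton, measure_cdf]

theorem massFunction_eq_real (D : ProbabilityMeasure ℝ) (x : ℝ) :
    massFunction D x = (D : Measure ℝ).real {x} := by
  rw [Measure.real, ← ofReal_massFunction, ENNReal.toReal_ofReal]
  exact sub_nonneg.2 ((monotone_cdf _).leftLim_le le_rfl)

/-- If every positive point `x` of the support has mass at least `x`, then the measure is purely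
discrete. -/
theorem isPurelyDiscrete_of_atoms {D : ProbabilityMeasure ℝ} (hD : OnUnitInterval D)
    (h : ∀ x > 0, x ∈ (D : Measure ℝ).support → ENNReal.ofReal x ≤ (D : Measure ℝ) {x}) :
    IsPurelyDiscrete D := by
  -- The point 0 is added by hand: it may lie in the support without being an atom.
  refine ⟨{0} ∪ {x | 0 < (D : Measure ℝ) {x}}, (Set.countable_singleton 0).union ?_, ?_⟩
  · exact Measure.countable_meas_level_set_pos (μ := (D : Measure ℝ)) measurable_id
  · filter_upwards [hD.ae_mem, Measure.support_mem_ae (μ := (D : Measure ℝ))] with x hx hxs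
    obtain h0 | h0 := hx.1.eq_or_lt
    · exact Or.inl h0.symm
    · exact Or.inr ((ENNReal.ofReal_pos.2 h0).trans_le (h x h0 hxs))

end Atoms

/-! ### Ball masses in a single structure. -/

section Balls

variable (L : FirstOrder.Language.{u, v}) {M : Type w} [L.Structure M]

theorem mem_closedNbhd_singleton {d : ℕ} {x y : M} :
    y ∈ closedNbhd L d {x} ↔ (gaifman L M).edist x y ≤ d := by
  simp [closedNbhd]

theorem closedNbhd_subset_closedNbhd {d e f : ℕ} {x y : M} (hy : y ∈ closedNbhd L d {x})
    (h : d + e ≤ f) : closedNbhd L e {y} ⊆ closedNbhd L f {x} := by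
  intro z hz
  rw [mem_closedNbhd_singleton] at *
  refine SimpleGraph.edist_triangle.trans ((add_le_add hy hz).trans ?_)
  exact_mod_cast h

theorem mem_closedNbhd_comm {d : ℕ} {x y : M} :
    y ∈ closedNbhd L d {x} ↔ x ∈ closedNbhd L d {y} := by
  rw [mem_closedNbhd_singleton, mem_closedNbhd_singleton, SimpleGraph.edist_comm]

variable [MeasurableSpace M] (ν : ProbabilityMeasure M)

theorem ballMass_mem_Icc (d : ℕ) (x : M) : ballMass L ν d x ∈ Set.Icc (0 : ℝ) 1 :=
  ⟨measureReal_nonneg, measureReal_le_one⟩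

theorem ballMass_le_ballMass {d e f : ℕ} {x y : M} (hy : y ∈ closedNbhd L d {x})
    (h : d + e ≤ f) : ballMass L ν e y ≤ ballMass L ν f x :=
  measureReal_mono (closedNbhd_subset_closedNbhd L hy h)

theorem ballMass_mono (x : M) {d e : ℕ} (h : d ≤ e) : ballMass L ν d x ≤ ballMass L ν e x :=
  ballMass_le_ballMass L ν (mem_closedNbhd_self L 0 rfl) (by omega)

variable [DiscreteMeasurableSpace M]

theorem ballLaw_apply (d : ℕ) {s : Set ℝ} (hs : MeasurableSet s) :
    (ballLaw L ν d : Measure ℝ) s = (ν : Measure M) {x | ballMass L ν d x ∈ s} :=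
  Measure.map_apply .of_discrete hs

theorem onUnitInterval_ballLaw (d : ℕ) : OnUnitInterval (ballLaw L ν d) := by
  rw [OnUnitInterval, ballLaw_apply L ν d measurableSet_Icc]
  simp [ballMass_mem_Icc L ν d]

theorem integral_ballLaw (d : ℕ) {f : ℝ → ℝ} (hf : Continuous f) :
    ∫ x, f x ∂(ballLaw L ν d : Measure ℝ) = ∫ x, f (ballMass L ν d x) ∂(ν : Measure M) :=
  integral_map Measurable.of_discrete.aemeasurable hf.aestronglyMeasurable

/-- By Fubini: once `x_0` is fixed, the other `k` elements fall into its ball independently, each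
with probability the ball mass. -/
theorem integral_pow_ballLaw [Finite M] [Finite {R : Σ k, L.Relations k | 2 ≤ R.1}] (d k : ℕ) :
    ∫ x, x ^ k ∂(ballLaw L ν d : Measure ℝ) = stonePairing (ballFormula L d k) ν := by
  have h1 : (Measure.pi fun _ : Fin (k + 1) => (ν : Measure M))
      {a | (ballFormula L d k).Realize a} =
      ((ν : Measure M).prod (Measure.pi fun _ : Fin k => (ν : Measure M)))
        {q | ∀ i, q.2 i ∈ closedNbhd L d {q.1}} := by
    rw [← (measurePreserving_piFinSuccAbove
      (fun _ : Fin (k + 1) => (ν : Measure M)) 0).measure_preimage_equiv]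
    congr 1
    ext a
    simp [realize_ballFormula, mem_closedNbhd_singleton, MeasurableEquiv.piFinSuccAbove,
      Fin.tail]
  have h2 : ((ν : Measure M).prod (Measure.pi fun _ : Fin k => (ν : Measure M)))
        {q | ∀ i, q.2 i ∈ closedNbhd L d {q.1}} =
      ∫⁻ x, ENNReal.ofReal (ballMass L ν d x ^ k) ∂(ν : Measure M) := by
    have := Fintype.ofFinite M
    rw [Measure.prod_apply (Set.toFinite _).measurableSet]
    refine lintegral_congr fun x => ?_
    have : Prod.mk x ⁻¹' {q : M × (Fin k → M) | ∀ i, q.2 i ∈ closedNbhd L d {q.1}} =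
        Set.univ.pi fun _ => closedNbhd L d {x} := by
      ext; simp
    rw [this, Measure.pi_pi, ENNReal.ofReal_pow (ballMass_mem_Icc L ν d x).1]
    simp [ballMass]
  rw [integral_ballLaw L ν d (by fun_prop), stonePairing, Measure.real, h1, h2,
    integral_eq_lintegral_of_nonneg_ae
      (Eventually.of_forall fun x => pow_nonneg (ballMass_mem_Icc L ν d x).1 k)
      Measurable.of_discrete.aestronglyMeasurable]

theorem integral_pow_ballLaw_mono [Finite M] (k : ℕ) {d e : ℕ} (h : d ≤ e) :
    ∫ x, x ^ k ∂(ballLaw L ν d : Measure ℝ) ≤ ∫ x, x ^ k ∂(ballLaw L ν e : Measure ℝ) := by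
  rw [integral_ballLaw L ν d (by fun_prop), integral_ballLaw L ν e (by fun_prop)]
  exact integral_mono Integrable.of_finite Integrable.of_finite fun x =>
    pow_le_pow_left₀ (ballMass_mem_Icc L ν d x).1 (ballMass_mono L ν x h) k

/-- If the ball mass barely grows between radii `d` and `3 * d` around some element whose
`d`-ball has mass close to `x`, then all elements of this ball have `2 * d`-balls of mass close
to `x`. -/
theorem le_ballLaw_Icc {d : ℕ} {x ε : ℝ} {a : M} (ha : x - ε < ballMass L ν d a)
    (ha' : ballMass L ν (3 * d) a < x + 2 * ε) :
    ENNReal.ofReal (x - ε) ≤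
      (ballLaw L ν (2 * d) : Measure ℝ) (Set.Icc (x - ε) (x + 2 * ε)) := by
  rw [ballLaw_apply L ν _ measurableSet_Icc]
  refine (ENNReal.ofReal_le_ofReal ha.le).trans ?_
  rw [ballMass, ofReal_measureReal]
  -- For `y` in the `d`-ball of `a`, the `2 * d`-ball of `y` contains the `d`-ball of `a` and is
  -- contained in its `3 * d`-ball.
  refine measure_mono fun y hy => ⟨?_, ?_⟩
  · exact ha.le.trans (ballMass_le_ballMass L ν ((mem_closedNbhd_comm L).1 hy) (by omega))
  · exact (ballMass_le_ballMass L ν hy (by omega)).trans ha'.le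

/-- A first moment criterion for the existence of an element as in `le_ballLaw_Icc`. -/
theorem exists_ballMass_of_integral_lt [Finite M] {d : ℕ} {x ε c : ℝ} (hε : 0 < ε) (hc : 0 ≤ c)
    (h : ENNReal.ofReal c < (ballLaw L ν d : Measure ℝ) (Set.Ioo (x - ε) (x + ε)))
    (hm : ∫ x, x ^ 1 ∂(ballLaw L ν (3 * d) : Measure ℝ) -
      ∫ x, x ^ 1 ∂(ballLaw L ν d : Measure ℝ) < ε * c) :
    ∃ a : M, x - ε < ballMass L ν d a ∧ ballMass L ν (3 * d) a < x + 2 * ε := by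
  by_contra! hcon
  rw [ballLaw_apply L ν d measurableSet_Ioo] at h
  rw [integral_ballLaw L ν d (by fun_prop), integral_ballLaw L ν _ (by fun_prop),
    ← integral_sub Integrable.of_finite Integrable.of_finite] at hm
  simp only [pow_one] at hm
  -- If no such element exists, every ball of mass in `(x - ε, x + ε)` grows to at least `x + 2 *
  -- ε`, hence by at least `ε`; Markov's inequality then contradicts `hm`.
  have hmarkov := mul_meas_ge_le_integral_of_nonneg (μ := (ν : Measure M))
    (f := fun a => ballMass L ν (3 * d) a - ballMass L ν d a)
    (Eventually.of_forall fun a => sub_nonneg.2 (ballMass_mono L ν a (by omega)))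
    Integrable.of_finite ε
  have hsub : (ν : Measure M) {a | ballMass L ν d a ∈ Set.Ioo (x - ε) (x + ε)} ≤
      (ν : Measure M) {a | ε ≤ ballMass L ν (3 * d) a - ballMass L ν d a} := by
    refine measure_mono fun a (ha : ballMass L ν d a ∈ Set.Ioo (x - ε) (x + ε)) => ?_
    have := hcon a ha.1
    change ε ≤ _
    linarith [ha.2]
  have h2 := h.trans_le hsub
  rw [← ofReal_measureReal, ENNReal.ofReal_lt_ofReal_iff_of_nonneg hc] at h2
  nlinarith [mul_lt_mul_of_pos_left h2 hε]

end Balls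

/-! ### Passage to the limits in `n` and `d`. -/

section Spectrum

variable (L : FirstOrder.Language.{u, v}) (A : ℕ → Type w) [∀ n, Finite (A n)]
  [∀ n, L.Structure (A n)] [∀ n, MeasurableSpace (A n)] [∀ n, DiscreteMeasurableSpace (A n)]
  (ν : ∀ n, ProbabilityMeasure (A n))

theorem exists_tendsto_ballLaw [L.IsRelational] (hL : {R : Σ k, L.Relations k | 2 ≤ R.1}.Finite)
    (hA : LocalConvergent L A ν) (d : ℕ) :
    ∃ E, Tendsto (fun n => ballLaw L (ν n) d) atTop (𝓝 E) := by
  have : Finite {R : Σ k, L.Relations k | 2 ≤ R.1} := hL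
  refine exists_tendsto_of_moments (fun n => onUnitInterval_ballLaw L (ν n) d) fun k => ?_
  simp_rw [integral_pow_ballLaw]
  exact hA _ _ (isLocal_ballFormula L d k)

variable {L A ν}

theorem exists_tendsto_integral_pow {E : ℕ → ProbabilityMeasure ℝ}
    (hE : ∀ d, Tendsto (fun n => ballLaw L (ν n) d) atTop (𝓝 (E d))) (k : ℕ) :
    ∃ m, Tendsto (fun d => ∫ x, x ^ k ∂(E d : Measure ℝ)) atTop (𝓝 m) := by
  have hlim : ∀ d, Tendsto (fun n => ∫ x, x ^ k ∂(ballLaw L (ν n) d : Measure ℝ)) atTop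
      (𝓝 (∫ x, x ^ k ∂(E d : Measure ℝ))) := fun d =>
    OnUnitInterval.tendsto_integral (hE d) (fun n => onUnitInterval_ballLaw L (ν n) d)
      (continuous_pow k)
  have hmono : Monotone fun d => ∫ x, x ^ k ∂(E d : Measure ℝ) := fun d e hde =>
    le_of_tendsto_of_tendsto' (hlim d) (hlim e) fun n => integral_pow_ballLaw_mono L (ν n) k hde
  refine ⟨_, tendsto_atTop_ciSup hmono ⟨1, ?_⟩⟩
  rintro _ ⟨d, rfl⟩
  exact (OnUnitInterval.integral_pow_mem_Icc
    (.of_tendsto (hE d) fun n => onUnitInterval_ballLaw L (ν n) d) k).2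

theorem ofReal_le_measure_singleton_of_mem_support {D : ProbabilityMeasure ℝ}
    (hD : IsSpectrumDistribution L A ν D) {x : ℝ} (hx : x ∈ (D : Measure ℝ).support) :
    ENNReal.ofReal x ≤ (D : Measure ℝ) {x} := by
  obtain ⟨E, hE, hED⟩ := hD
  refine le_measure_singleton_of_forall fun ε hε => ?_
  have hpos : 0 < (D : Measure ℝ) (Set.Ioo (x - ε) (x + ε)) :=
    (Measure.mem_support_iff_forall x).1 hx _ (Ioo_mem_nhds (by linarith) (by linarith))
  obtain ⟨c, hc0, hc⟩ : ∃ c : ℝ, 0 < c ∧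
      ENNReal.ofReal c < (D : Measure ℝ) (Set.Ioo (x - ε) (x + ε)) := by
    obtain ⟨c, hc0, hc⟩ := ENNReal.lt_iff_exists_real_btwn.1 hpos
    exact ⟨c, ENNReal.ofReal_pos.1 hc.1, hc.2⟩
  obtain ⟨m, hm⟩ := exists_tendsto_integral_pow hE 1
  -- The first moments at radii `d` and `3 * d` have the same limit `m`.
  have hdiff : ∀ᶠ d in atTop, ∫ x, x ^ 1 ∂(E (3 * d) : Measure ℝ) -
      ∫ x, x ^ 1 ∂(E d : Measure ℝ) < ε * c := by
    have h3 : Tendsto (fun d : ℕ => 3 * d) atTop atTop :=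
      tendsto_atTop_mono (fun d => by simp only [id]; omega) tendsto_id
    refine ((hm.comp h3).sub hm).eventually_lt_const ?_
    rw [sub_self]
    positivity
  have h2 : Tendsto (fun d : ℕ => 2 * d) atTop atTop :=
    tendsto_atTop_mono (fun d => by simp only [id]; omega) tendsto_id
  -- Open sets carry the bound from `D` to `E d` and then to finite structures; closed sets bring it
  -- back, along the radii `2 * d`.
  refine le_measure_of_isClosed (hED.comp h2) isClosed_Icc ?_
  filter_upwards [hdiff, eventually_lt_measure_of_isOpen hED isOpen_Ioo hc] with d hd hd'
  refine le_measure_of_isClosed (hE (2 * d)) isClosed_Icc ?_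
  have hmom : ∀ e, Tendsto (fun n => ∫ x, x ^ 1 ∂(ballLaw L (ν n) e : Measure ℝ)) atTop
      (𝓝 (∫ x, x ^ 1 ∂(E e : Measure ℝ))) := fun e =>
    OnUnitInterval.tendsto_integral (hE e) (fun n => onUnitInterval_ballLaw L (ν n) e)
      (continuous_pow 1)
  filter_upwards [((hmom (3 * d)).sub (hmom d)).eventually_lt_const hd,
    eventually_lt_measure_of_isOpen (hE d) isOpen_Ioo hd'] with n hn hn'
  obtain ⟨a, ha, ha'⟩ := exists_ballMass_of_integral_lt L (ν n) hε hc0.le hn' hn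
  exact le_ballLaw_Icc L (ν n) ha ha'

end Spectrum

end SpectrumClustering

open SpectrumClustering
theorem mainTheorem8 (L : FirstOrder.Language.{u, v}) [L.IsRelational]
    (hL : {R : Σ k, L.Relations k | 2 ≤ R.1}.Finite)
    (A : ℕ → Type w) [∀ n, Finite (A n)] [∀ n, L.Structure (A n)]
    [∀ n, MeasurableSpace (A n)] [∀ n, DiscreteMeasurableSpace (A n)]
    (ν : ∀ n, ProbabilityMeasure (A n)) (hA : LocalConvergent L A ν) :
    (∃! D : ProbabilityMeasure ℝ, IsSpectrumDistribution L A ν D) ∧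
      ∀ D : ProbabilityMeasure ℝ, IsSpectrumDistribution L A ν D →
        (D : Measure ℝ) (Set.Icc 0 1) = 1 ∧ IsPurelyDiscrete D ∧
          ∀ x ∈ Set.Icc (0 : ℝ) 1, massFunction D x = 0 ∨ x ≤ massFunction D x := by
  have hunit : ∀ {E : ℕ → ProbabilityMeasure ℝ},
      (∀ d, Tendsto (fun n => ballLaw L (ν n) d) atTop (𝓝 (E d))) →
      ∀ d, OnUnitInterval (E d) := fun hE d =>
    .of_tendsto (hE d) fun n => onUnitInterval_ballLaw L (ν n) d
  refine ⟨?_, fun D hD => ?_⟩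
  · choose E hE using exists_tendsto_ballLaw L A ν hL hA
    obtain ⟨D, hD⟩ := exists_tendsto_of_moments (hunit hE) (exists_tendsto_integral_pow hE)
    refine ⟨D, ⟨E, hE, hD⟩, ?_⟩
    rintro D' ⟨E', hE', hD'⟩
    obtain rfl : E' = E := funext fun d => tendsto_nhds_unique (hE' d) (hE d)
    exact tendsto_nhds_unique hD' hD
  · have hI : OnUnitInterval D := by
      obtain ⟨E, hE, hED⟩ := hD
      exact .of_tendsto hED (hunit hE)
    refine ⟨hI, isPurelyDiscrete_of_atoms hI fun x _ hx =>
      ofReal_le_measure_singleton_of_mem_support hD hx, fun x _ => ?_⟩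
    rw [massFunction_eq_real]
    by_cases hx : x ∈ (D : Measure ℝ).support
    · right
      exact (ENNReal.ofReal_le_iff_le_toReal (measure_ne_top _ _)).1
        (ofReal_le_measure_singleton_of_mem_support hD hx)
    · left
      have : (D : Measure ℝ) {x} = 0 := measure_mono_null (Set.singleton_subset_iff.2 hx)
        Measure.measure_compl_support
      simp [Measure.real, this]
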